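/- A \emph{quotient Borel space} $(X,E)$ is a standard Borel space $X$ together with a countable Borel equivalence relation $E$ on it; its underlying set is $X/E$. A relation $R\subseteq X/E\times Y/F$ is \emph{Borel} if its preimage in $X\times Y$ is Borel, and a function $X/E\to Y/F$ is Borel if its graph is. An equivalence relation $F$ on $X/E$ is \emph{Borel countably generated} if there is a sequence of Borel functions $f_n:X/E\to X/E$ such that $F$ is the smallest equivalence relation on $X/E$ containing the graphs of all $f_n$. For equivalence relations $E\subseteq F$ on $X$, $F/E$ denotes the induced equivalence relation on $X/E$; $F$ has \emph{index $3$ over $E$} if every $F/E$-class has exactly three elements. Let $S_3$ act componentwise on the space $3^{\omega}$ of ternary sequences. Let $E_0$ be the relation of eventual equality on $3^\omega$ and, for a subgroup $\Delta\le S_3$, let $E_0(\Delta)$ be the equivalence relation generated by $E_0$ and the orbit equivalence relation of $\Delta$. Let $\sigma(x)_n=x_{n+1}$ be the shift and let $3^\omega_*=\{x\in 3^\omega : \forall m,n\ (\sigma^m(x)=\sigma^n(x)\rightarrow m=n)\}$ be the set of aperiodic sequences. (1) $3^\omega_*$ is cocountable in $3^\omega$, is a $\mathbf{\Pi}^0_2$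 (i.e. $G_\delta$) set, and is $E_0(S_3)$-invariant. From now on all relations are restricted to $3^\omega_*$. (2) $(3^\omega_*,E_0)$ and $(3^\omega_*,E_0(\Delta))$, for every $\Delta\le S_3$, are quotient Borel spaces. The induced action of $S_3$ on $(3^\omega_*,E_0)$ is Borel (each group element acts by a Borel function) and free, and for every $\Delta\leq S_3$ the orbit equivalence relation of $\Delta$ on $3^\omega_*/E_0$ is $E_0(\Delta)/E_0$. (3) Let $\mu$ be the measure on $3^\omega_*/E_0$ (with the quotient $\sigma$-algebra) obtained by restricting to $3^\omega_*$ the $\omega$-th power of the $(\frac13,\frac13,\frac13)$-measure on $3$ and pushing it forward along the quotient map. Then $\mu$ is a probability measure taking only the values $0$ and $1$, and it is $S_3$-invariant. (4) Let $S_2\le S_3$ be a subgroup generated by a transposition. Then $[S_3:S_2]=3$, the normalizer $N_{S_3}(S_2)$ equals $S_2$, and $E_0(S_3)/E_0(S_2)$ is a Borel equivalence relation on $(3^\omega_*,E_0(S_2))$, of index $3$. Every equivalence relation $F\subseteq E_0(S_3)/E_0(S_2)$ on $3^\omega_*/E_0(S_2)$ that is Borel countably generated is $\mu$-almost equal to the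 identity, that is, the set of all $[x]_{E_0}\in 3^\omega_*/E_0$ such that the $F$-class of $[x]_{E_0(S_2)}$ has more than one element is $\mu$-null. Moreover $E_0(S_3)/E_0(S_2)$ is not Borel countably generated. -/

import Mathlib

open MeasureTheory

namespace QuotientBorel

/-! ### Quotient Borel spaces -/

/-- `(X, E)` is a quotient Borel space: `X` is a standard Borel space and `E` is a countable Borel
equivalence relation on `X`. -/
structure IsQuotientBorelSpace {X : Type*} [MeasurableSpace X] (E : Setoid X) : Prop where
  standardBorel : StandardBorelSpace X
  measurableSet_graph : MeasurableSet {p : X × X | E p.1 p.2}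
  countable_class : ∀ x : X, {y : X | E x y}.Countable

/-- A binary relation `R` between the quotient spaces `(X, E)` and `(Y, F)` is Borel if its
preimage in `X × Y` is Borel. -/
def IsBorelRel {X Y : Type*} [MeasurableSpace X] [MeasurableSpace Y] (E : Setoid X) (F : Setoid Y)
    (R : Quotient E → Quotient F → Prop) : Prop :=
  MeasurableSet {p : X × Y | R (Quotient.mk E p.1) (Quotient.mk F p.2)}

/-- A function between quotient Borel spaces is Borel if its graph is a Borel relation. -/
def IsBorelFun {X Y : Type*} [MeasurableSpace X] [MeasurableSpace Y] (E : Setoid X) (F : Setoid Y)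
    (f : Quotient E → Quotient F) : Prop :=
  IsBorelRel E F (fun a b => f a = b)

/-- An equivalence relation `F` on the quotient Borel space `(X, E)` is Borel countably generated
if there is a sequence of Borel endomorphisms of `(X, E)` such that `F` is the smallest equivalence
relation containing their graphs. -/
def IsBorelCountablyGenerated {X : Type*} [MeasurableSpace X] (E : Setoid X)
    (F : Setoid (Quotient E)) : Prop :=
  ∃ f : ℕ → Quotient E → Quotient E, (∀ n, IsBorelFun E E (f n)) ∧
    IsLeast {S : Setoid (Quotient E) | ∀ n a, S a (f n a)} F

/-- The quotient relation `F / E` on `X / E`, for equivalence relations `E ⊆ F` on `X`: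
two classes `[x]_E`, `[y]_E` are related iff `x F y`. -/
def quotRel {X : Type*} {E F : Setoid X} (h : E ≤ F) : Setoid (Quotient E) :=
  Setoid.ker (Quotient.map id h : Quotient E → Quotient F)

theorem quotRel_mk_iff {X : Type*} {E F : Setoid X} (h : E ≤ F) (x y : X) :
    quotRel h (Quotient.mk E x) (Quotient.mk E y) ↔ F x y :=
  Quotient.eq (r := F)

/-- All classes of the equivalence relation `F` have exactly `n` elements. -/
def HasIndex {Z : Type*} (F : Setoid Z) (n : ℕ) : Prop :=
  ∀ a : Z, {b : Z | F a b}.encard = n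

/-! ### Ternary sequences -/

/-- The space of infinite ternary sequences. -/
abbrev Ternary : Type := ℕ → Fin 3

/-- The symmetric group on three elements. It acts on `Ternary` componentwise, through the instance
`Pi.mulAction`: `(σ • x) n = σ (x n)`. -/
abbrev S₃ : Type := Equiv.Perm (Fin 3)

theorem smul_ternary_apply (σ : S₃) (x : Ternary) (n : ℕ) : (σ • x) n = σ (x n) := rfl

/-- Eventual equality of ternary sequences. -/
def E₀ : Setoid Ternary where
  r x y := ∃ n₀, ∀ n ≥ n₀, x n = y n
  iseqv :=
    { refl := fun _ => ⟨0, fun _ _ => rfl⟩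
      symm := fun ⟨n₀, h⟩ => ⟨n₀, fun n hn => (h n hn).symm⟩
      trans := fun ⟨n₀, h⟩ ⟨n₁, h'⟩ => ⟨max n₀ n₁, fun n hn =>
        (h n (le_trans (le_max_left _ _) hn)).trans (h' n (le_trans (le_max_right _ _) hn))⟩ }

/-- `E₀(Δ)`: the equivalence relation generated by `E₀` and the orbit equivalence relation of the
componentwise action of `Δ`. -/
def E₀Gen (Δ : Subgroup S₃) : Setoid Ternary := E₀ ⊔ MulAction.orbitRel Δ Ternary

theorem E₀Gen_iff (Δ : Subgroup S₃) (x y : Ternary) :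
    E₀Gen Δ x y ↔ ∃ σ ∈ Δ, E₀ y (σ • x) := by
  constructor
  · intro h
    let S : Setoid Ternary :=
      { r := fun x y => ∃ σ ∈ Δ, ∃ n₀ : ℕ, ∀ n ≥ n₀, y n = σ (x n)
        iseqv :=
          { refl := fun x => ⟨1, Δ.one_mem, 0, fun _ _ => rfl⟩
            symm := by
              rintro x y ⟨σ, hσ, n₀, h⟩
              exact ⟨σ⁻¹, Δ.inv_mem hσ, n₀, fun n hn => by simp [h n hn]⟩
            trans := by
              rintro x y z ⟨σ, hσ, n₀, h⟩ ⟨τ, hτ, n₁, h'⟩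
              refine ⟨τ * σ, Δ.mul_mem hτ hσ, max n₀ n₁, fun n hn => ?_⟩
              rw [h' n (le_trans (le_max_right _ _) hn), h n (le_trans (le_max_left _ _) hn)]
              rfl } }
    have hle : E₀Gen Δ ≤ S := by
      refine sup_le ?_ ?_
      · rintro x y ⟨n₀, h⟩
        exact ⟨1, Δ.one_mem, n₀, fun n hn => (h n hn).symm⟩
      · rintro x y ⟨σ, rfl⟩
        exact ⟨(σ⁻¹ : Δ), (σ⁻¹).2, 0, fun n _ => by
          change y n = ((σ : S₃)⁻¹) ((σ : S₃) (y n))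
          simp⟩
    exact hle h
  · rintro ⟨σ, hσ, h⟩
    have h₁ : E₀Gen Δ (σ • x) x :=
      (le_sup_right : MulAction.orbitRel Δ Ternary ≤ E₀Gen Δ) ⟨⟨σ, hσ⟩, rfl⟩
    have h₂ : E₀Gen Δ y (σ • x) := (le_sup_left : E₀ ≤ E₀Gen Δ) h
    exact (E₀Gen Δ).symm ((E₀Gen Δ).trans h₂ h₁)

/-- The shift `(xₙ) ↦ (xₙ₊₁)`. -/
def shift (x : Ternary) : Ternary := fun n => x (n + 1)

/-- The set of aperiodic sequences. -/
def aperiodicSet : Set Ternary := {x | ∀ m n : ℕ, shift^[m] x = shift^[n] x → m = n}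

/-- The space of aperiodic ternary sequences, with the Borel structure inherited from `Ternary`. -/
abbrev Aperiodic : Type := aperiodicSet

/-- The restriction of `E₀` to the aperiodic sequences. -/
def E₀' : Setoid Aperiodic := E₀.comap Subtype.val

/-- The restriction of `E₀(Δ)` to the aperiodic sequences. -/
def E₀Gen' (Δ : Subgroup S₃) : Setoid Aperiodic := (E₀Gen Δ).comap Subtype.val

theorem E₀'_le_E₀Gen' (Δ : Subgroup S₃) : E₀' ≤ E₀Gen' Δ := by
  intro x y h
  exact (le_sup_left : E₀ ≤ E₀Gen Δ) h

theorem E₀Gen'_mono {Δ Γ : Subgroup S₃} (h : Δ ≤ Γ) : E₀Gen' Δ ≤ E₀Gen' Γ := by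
  have key : E₀Gen Δ ≤ E₀Gen Γ := by
    refine sup_le_sup le_rfl ?_
    rintro x y ⟨σ, hσ⟩
    exact ⟨⟨σ.1, h σ.2⟩, hσ⟩
  intro x y hxy
  exact key hxy

theorem shift_iterate_apply (m : ℕ) (x : Ternary) (k : ℕ) : shift^[m] x k = x (k + m) := by
  induction m generalizing x with
  | zero => rfl
  | succ m ih => rw [Function.iterate_succ_apply, ih]; rfl

theorem smul_mem_aperiodicSet (σ : S₃) {x : Ternary} (hx : x ∈ aperiodicSet) :
    σ • x ∈ aperiodicSet := by
  intro m n h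
  refine hx m n (funext fun k => ?_)
  have hk := congrFun h k
  simp only [shift_iterate_apply] at hk ⊢
  exact σ.injective hk

/-- The componentwise action of `S₃` on the aperiodic sequences. -/
instance instMulActionAperiodic : MulAction S₃ Aperiodic where
  smul σ x := ⟨σ • x.1, smul_mem_aperiodicSet σ x.2⟩
  one_smul x := Subtype.ext (one_smul S₃ x.1)
  mul_smul σ τ x := Subtype.ext (mul_smul σ τ x.1)

theorem E₀'_smul (σ : S₃) {x y : Aperiodic} (h : E₀' x y) : E₀' (σ • x) (σ • y) := by
  obtain ⟨n₀, h⟩ := h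
  exact ⟨n₀, fun n hn => congrArg σ (h n hn)⟩

/-- The induced action of `S₃` on the quotient of the aperiodic sequences by `E₀`:
`σ • [x] = [σ • x]`. -/
instance instMulActionQuotient : MulAction S₃ (Quotient E₀') where
  smul σ := Quotient.map (σ • ·) (fun _ _ h => E₀'_smul σ h)
  one_smul a := Quotient.inductionOn a fun x => congrArg (Quotient.mk E₀') (one_smul S₃ x)
  mul_smul σ τ a :=
    Quotient.inductionOn a fun x => congrArg (Quotient.mk E₀') (mul_smul σ τ x)

theorem smul_mk (σ : S₃) (x : Aperiodic) :
    σ • Quotient.mk E₀' x = Quotient.mk E₀' (σ • x) := rfl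

/-- Haar measure on the space of ternary sequences: the countable power of the
`(1/3, 1/3, 1/3)`-measure. -/
noncomputable def haarTernary : Measure Ternary :=
  Measure.infinitePi fun _ : ℕ => (PMF.uniformOfFintype (Fin 3)).toMeasure

/-- The quotient measure: the restriction of Haar measure to the aperiodic sequences, pushed forward
to the quotient by `E₀` (which carries the quotient σ-algebra). -/
noncomputable def quotientMeasure : Measure (Quotient E₀') :=
  (haarTernary.comap (Subtype.val : Aperiodic → Ternary)).map (Quotient.mk E₀')

/-- For an equivalence relation `F` on the quotient space of `E₀(Δ)`, the set of those points
`[x]` of the quotient space of `E₀` such that the `F`-class of the `E₀(Δ)`-class of `x` has more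
than one element. -/
def nontrivialDomain (Δ : Subgroup S₃) (F : Setoid (Quotient (E₀Gen' Δ))) :
    Set (Quotient E₀') :=
  {a | ∃ b : Quotient (E₀Gen' Δ),
    F (Quotient.map id (E₀'_le_E₀Gen' Δ) a) b ∧ b ≠ Quotient.map id (E₀'_le_E₀Gen' Δ) a}

/-- An equivalence relation on the quotient space of `E₀(Δ)` is almost equal to the identity if it
coincides with the identity up to a null set of points of the quotient space of `E₀`. -/
def IsAlmostIdentity (Δ : Subgroup S₃) (F : Setoid (Quotient (E₀Gen' Δ))) : Prop :=
  quotientMeasure (nontrivialDomain Δ F) = 0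

end QuotientBorel

namespace QuotientBorel

open Filter ProbabilityTheory

/-! ### The symmetric group on three letters -/

/-! Ergodicity plus self-normalization of S₂ = ⟨τ⟩ rules out Borel generators. Suppose a Borel `f`
on the quotient by E₀(S₂) has graph inside E₀(S₃)/E₀(S₂). Then `f` sends the class of each `a` to
the class of `σ • a` for some `σ` depending on `a`. Only six `σ` are available and the zero-one law
applies to each of the corresponding sets, so a single `σ` works almost everywhere.

The measure is invariant, so the same `σ` works at `τ • a` for almost every `a`. But `a` and `τ • a`
have the same class, so `σ • a` and `σ • τ • a` do too. The action modulo E₀ is free, hence `σ * τ *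
σ⁻¹` lies in S₂, hence `σ` itself does, and `f` is almost everywhere the identity
(`ae_eq_of_graph_le`).

Countably many such `f` are all trivial on a conull S₃-invariant set, so the relation they generate
is trivial there. Since E₀(S₃)/E₀(S₂) is trivial nowhere, it is not Borel countably generated. -/

theorem perm_fixes_at_most_one : ∀ σ : S₃, ∀ i j : Fin 3, σ i = i → σ j = j → i ≠ j → σ = 1 := by
  decide

/-- Membership in ⟨τ⟩ = {1, τ} is spelled out as a disjunction, so that self-normalization becomes a
finite check. -/
theorem involution_self_normalizing : ∀ τ σ : S₃, τ ≠ 1 → τ * τ = 1 →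
    (σ * τ * σ⁻¹ = 1 ∨ σ * τ * σ⁻¹ = τ) → σ = 1 ∨ σ = τ := by
  decide

theorem isSwap_mul_self {τ : S₃} (h : τ.IsSwap) : τ * τ = 1 := by
  obtain ⟨i, j, -, rfl⟩ := h
  exact Equiv.swap_mul_self i j

theorem isSwap_ne_one {τ : S₃} (h : τ.IsSwap) : τ ≠ 1 := by
  obtain ⟨i, j, hij, rfl⟩ := h
  exact fun h => hij (Equiv.swap_eq_one_iff.1 h)

theorem mem_zpowers_isSwap {τ : S₃} (h : τ.IsSwap) (σ : S₃) :
    σ ∈ Subgroup.zpowers τ ↔ σ = 1 ∨ σ = τ := by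
  constructor
  · rintro ⟨k, rfl⟩
    have h2 : τ ^ (2 : ℤ) = 1 := by
      rw [zpow_two]
      exact isSwap_mul_self h
    obtain ⟨m, rfl | rfl⟩ := Int.even_or_odd' k
    · exact Or.inl (by simp [zpow_mul, h2])
    · exact Or.inr (by simp [zpow_add, zpow_mul, h2])
  · rintro (rfl | rfl)
    · exact one_mem _
    · exact Subgroup.mem_zpowers _

theorem mem_zpowers_of_conj_mem {τ : S₃} (h : τ.IsSwap) {σ : S₃}
    (hσ : σ * τ * σ⁻¹ ∈ Subgroup.zpowers τ) : σ ∈ Subgroup.zpowers τ := by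
  rw [mem_zpowers_isSwap h] at hσ ⊢
  exact involution_self_normalizing τ σ (isSwap_ne_one h) (isSwap_mul_self h) hσ

theorem index_zpowers_isSwap {τ : S₃} (h : τ.IsSwap) : (Subgroup.zpowers τ).index = 3 := by
  have h1 := (Subgroup.zpowers τ).card_mul_index
  have h2 : Nat.card S₃ = 6 := by
    rw [Nat.card_eq_fintype_card]
    decide
  rw [Nat.card_zpowers, h.orderOf, h2] at h1
  omega

theorem normalizer_zpowers_isSwap {τ : S₃} (h : τ.IsSwap) :
    Subgroup.normalizer (Subgroup.zpowers τ : Set S₃) = Subgroup.zpowers τ := by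
  refine le_antisymm (fun σ hσ => ?_) Subgroup.le_normalizer
  exact mem_zpowers_of_conj_mem h
    ((Subgroup.mem_normalizer_iff.1 hσ τ).1 (Subgroup.mem_zpowers τ))

/-! ### Aperiodic sequences -/

theorem compl_aperiodicSet :
    aperiodicSetᶜ = ⋃ m : ℕ, ⋃ n : ℕ, ⋃ _ : m < n, {x | shift^[m] x = shift^[n] x} := by
  ext x
  simp only [aperiodicSet, Set.mem_compl_iff, Set.mem_ofPred_eq, Set.mem_iUnion, not_forall]
  constructor
  · rintro ⟨m, n, h, hmn⟩
    rcases lt_or_gt_of_ne hmn with hlt | hlt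
    · exact ⟨m, n, hlt, h⟩
    · exact ⟨n, m, hlt, h.symm⟩
  · rintro ⟨m, n, hlt, h⟩
    exact ⟨m, n, h, hlt.ne⟩

/-- The first `n` letters determine such a sequence: for `k ≥ n` the letter at `k` equals the one at
the smaller index `k - n + m`. -/
theorem eventuallyPeriodic_countable {m n : ℕ} (h : m < n) :
    {x | shift^[m] x = shift^[n] x}.Countable := by
  refine Set.MapsTo.countable_of_injOn (f := fun x (i : Fin n) => x i) (Set.mapsTo_univ _ _)
    ?_ (Set.to_countable _)
  intro x hx y hy hxy
  funext k
  induction k using Nat.strong_induction_on with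
  | _ k ih =>
    rcases lt_or_ge k n with hk | hk
    · exact congrFun hxy ⟨k, hk⟩
    · have key : ∀ z : Ternary, shift^[m] z = shift^[n] z → z k = z (k - n + m) := fun z hz => by
        have := congrFun hz (k - n)
        rw [shift_iterate_apply, shift_iterate_apply, Nat.sub_add_cancel hk] at this
        exact this.symm
      rw [key x hx, key y hy]
      exact ih _ (by omega)

theorem countable_compl_aperiodicSet : aperiodicSetᶜ.Countable := by
  rw [compl_aperiodicSet]
  exact Set.countable_iUnion fun m => Set.countable_iUnion fun n => Set.countable_iUnion fun h =>
    eventuallyPeriodic_countable h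

theorem isGδ_aperiodicSet : IsGδ aperiodicSet := by
  rw [← compl_compl aperiodicSet]
  exact countable_compl_aperiodicSet.isGδ_compl

theorem measurableSet_aperiodicSet : MeasurableSet aperiodicSet :=
  isGδ_aperiodicSet.measurableSet

theorem E₀_smul_mem_aperiodicSet {x y : Ternary} (σ : S₃) (h : E₀ y (σ • x))
    (hx : x ∈ aperiodicSet) : y ∈ aperiodicSet := by
  obtain ⟨N, hN⟩ := h
  intro m n hmn
  refine Nat.add_right_cancel (m := N) (hx (m + N) (n + N) (funext fun k => ?_))
  have hk := congrFun hmn (k + N)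
  rw [shift_iterate_apply, shift_iterate_apply, hN _ (by omega), hN _ (by omega)] at hk
  have hk := σ.injective hk
  rw [shift_iterate_apply, shift_iterate_apply]
  rwa [add_assoc, add_assoc, add_comm N, add_comm N] at hk

theorem E₀Gen'_iff (Δ : Subgroup S₃) (x y : Aperiodic) :
    E₀Gen' Δ x y ↔ ∃ σ ∈ Δ, E₀' y (σ • x) :=
  E₀Gen_iff Δ x.1 y.1

/-- This is freeness. A nontrivial permutation fixes at most one letter, so `x` would be constant
from `N` on, and its shifts by `N` and `N + 1` would coincide. -/
theorem eq_one_of_E₀'_smul {σ : S₃} {x : Aperiodic} (h : E₀' (σ • x) x) : σ = 1 := by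
  obtain ⟨N, hN⟩ := h
  by_contra hσ
  have hc : ∀ n ≥ N, ∀ m ≥ N, x.1 n = x.1 m := fun n hn m hm => by
    by_contra hne
    exact hσ (perm_fixes_at_most_one σ _ _ (hN n hn) (hN m hm) hne)
  have := x.2 N (N + 1) (funext fun k => by
    rw [shift_iterate_apply, shift_iterate_apply]
    exact hc _ (by omega) _ (by omega))
  omega

theorem smul_injective_E₀' {σ ρ : S₃} {x : Aperiodic} (h : E₀' (σ • x) (ρ • x)) : σ = ρ := by
  have h1 : E₀' ((ρ⁻¹ * σ) • x) x := by
    have := E₀'_smul ρ⁻¹ h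
    rwa [← mul_smul, ← mul_smul, inv_mul_cancel, one_smul] at this
  exact (inv_mul_eq_one.1 (eq_one_of_E₀'_smul h1)).symm

theorem E₀Gen'_smul_smul_iff (Δ : Subgroup S₃) (σ ρ : S₃) (x : Aperiodic) :
    E₀Gen' Δ (σ • x) (ρ • x) ↔ ρ * σ⁻¹ ∈ Δ := by
  rw [E₀Gen'_iff]
  constructor
  · rintro ⟨δ, hδ, h⟩
    rw [← mul_smul] at h
    rw [smul_injective_E₀' h]
    simpa using hδ
  · intro h
    refine ⟨_, h, ?_⟩
    rw [← mul_smul, inv_mul_cancel_right]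

/-! ### Countable Borel equivalence relations -/

theorem measurable_aperiodic_apply (n : ℕ) : Measurable fun x : Aperiodic => x.1 n :=
  (measurable_pi_apply n).comp measurable_subtype_coe

theorem measurable_smul_ternary (σ : S₃) : Measurable fun x : Ternary => σ • x :=
  measurable_pi_lambda _ fun n =>
    (Measurable.of_discrete (f := (σ : Fin 3 → Fin 3))).comp (measurable_pi_apply n)

theorem measurable_smul_aperiodic (σ : S₃) : Measurable fun x : Aperiodic => σ • x :=
  ((measurable_smul_ternary σ).comp measurable_subtype_coe).subtype_mk

theorem measurableSet_E₀' : MeasurableSet {p : Aperiodic × Aperiodic | E₀' p.1 p.2} := by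
  have : {p : Aperiodic × Aperiodic | E₀' p.1 p.2} =
      ⋃ N : ℕ, ⋂ n : ℕ, ⋂ _ : n ≥ N, {p | p.1.1 n = p.2.1 n} := by
    ext p
    simp only [Set.mem_iUnion, Set.mem_iInter, Set.mem_ofPred_eq]
    rfl
  rw [this]
  exact .iUnion fun N => .iInter fun n => .iInter fun _ => measurableSet_eq_fun
    ((measurable_aperiodic_apply n).comp measurable_fst)
    ((measurable_aperiodic_apply n).comp measurable_snd)

theorem measurableSet_E₀Gen' (Δ : Subgroup S₃) :
    MeasurableSet {p : Aperiodic × Aperiodic | E₀Gen' Δ p.1 p.2} := by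
  have : {p : Aperiodic × Aperiodic | E₀Gen' Δ p.1 p.2} =
      ⋃ σ : S₃, ⋃ _ : σ ∈ Δ, {p | E₀' p.2 (σ • p.1)} := by
    ext p
    simp only [Set.mem_iUnion, Set.mem_ofPred_eq, E₀Gen'_iff, exists_prop]
  rw [this]
  exact .iUnion fun σ => .iUnion fun _ => measurableSet_E₀'.preimage
    (measurable_snd.prodMk ((measurable_smul_aperiodic σ).comp measurable_fst))

theorem countable_E₀'_class (x : Aperiodic) : {y | E₀' x y}.Countable := by
  have : {y | E₀' x y} ⊆ ⋃ N : ℕ, {y : Aperiodic | ∀ n ≥ N, x.1 n = y.1 n} := by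
    rintro y ⟨N, hN⟩
    exact Set.mem_iUnion.2 ⟨N, hN⟩
  refine Set.Countable.mono this (Set.countable_iUnion fun N => ?_)
  refine Set.MapsTo.countable_of_injOn (f := fun y (i : Fin N) => y.1 i) (Set.mapsTo_univ _ _)
    ?_ (Set.to_countable _)
  intro y hy z hz h
  refine Subtype.ext (funext fun n => ?_)
  rcases lt_or_ge n N with hn | hn
  · exact congrFun h ⟨n, hn⟩
  · exact (hy n hn).symm.trans (hz n hn)

theorem standardBorelSpace_aperiodic : StandardBorelSpace Aperiodic :=
  measurableSet_aperiodicSet.standardBorel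

theorem isQuotientBorelSpace_E₀' : IsQuotientBorelSpace E₀' :=
  ⟨standardBorelSpace_aperiodic, measurableSet_E₀', countable_E₀'_class⟩

theorem isQuotientBorelSpace_E₀Gen' (Δ : Subgroup S₃) : IsQuotientBorelSpace (E₀Gen' Δ) := by
  refine ⟨standardBorelSpace_aperiodic, measurableSet_E₀Gen' Δ, fun x => ?_⟩
  have : {y | E₀Gen' Δ x y} ⊆ ⋃ σ : S₃, {y | E₀' (σ • x) y} := by
    intro y hy
    obtain ⟨σ, -, h⟩ := (E₀Gen'_iff Δ x y).1 hy
    exact Set.mem_iUnion.2 ⟨σ, E₀'.symm h⟩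
  exact (Set.countable_iUnion fun σ => countable_E₀'_class _).mono this

theorem isBorelFun_smul (σ : S₃) : IsBorelFun E₀' E₀' (fun a => σ • a) := by
  have : {p : Aperiodic × Aperiodic | σ • Quotient.mk E₀' p.1 = Quotient.mk E₀' p.2} =
      {p | E₀' (σ • p.1) p.2} := by
    ext p
    exact Quotient.eq
  unfold IsBorelFun IsBorelRel
  rw [this]
  exact measurableSet_E₀'.preimage
    (((measurable_smul_aperiodic σ).comp measurable_fst).prodMk measurable_snd)

theorem eq_one_of_smul_eq (σ : S₃) (a : Quotient E₀') (h : σ • a = a) : σ = 1 := by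
  induction a using Quotient.inductionOn with
  | h x => exact eq_one_of_E₀'_smul (Quotient.exact h)

theorem quotRel_eq_orbitRel (Δ : Subgroup S₃) :
    quotRel (E₀'_le_E₀Gen' Δ) = MulAction.orbitRel Δ (Quotient E₀') := by
  refine Setoid.ext fun a b => ?_
  induction a using Quotient.inductionOn with
  | h x =>
  induction b using Quotient.inductionOn with
  | h y =>
  rw [quotRel_mk_iff, Setoid.comm', E₀Gen'_iff, MulAction.orbitRel_apply]
  constructor
  · rintro ⟨σ, hσ, h⟩
    exact ⟨⟨σ, hσ⟩, (Quotient.sound h).symm⟩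
  · rintro ⟨⟨σ, hσ⟩, h⟩
    exact ⟨σ, hσ, Quotient.exact h.symm⟩

/-! ### The quotient measure -/

instance isProbabilityMeasure_haarTernary : IsProbabilityMeasure haarTernary := by
  unfold haarTernary
  infer_instance

instance nullSingletonClass_haarTernary : NullSingletonClass haarTernary where
  measure_singleton x := by
    have h1 : ∀ n : ℕ, haarTernary {x} ≤ (3⁻¹ : ENNReal) ^ n := fun n => by
      calc haarTernary {x} ≤ haarTernary (Set.pi (Finset.range n) fun i => {x i}) :=
            measure_mono fun y hy i _ => by rw [hy]; rfl
        _ = _ := by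
            unfold haarTernary
            rw [Measure.infinitePi_pi _ fun i _ => measurableSet_singleton _]
            simp
    have h2 : Tendsto (fun n : ℕ => (3⁻¹ : ENNReal) ^ n) atTop (nhds 0) :=
      ENNReal.tendsto_pow_atTop_nhds_zero_of_lt_one (by simp)
    exact le_antisymm (ge_of_tendsto' h2 h1) zero_le

/-- Kolmogorov's zero-one law: the coordinates are independent, and an E₀-invariant Borel set is a
tail event. -/
theorem measure_zero_or_one_of_E₀_invariant {B : Set Ternary} (hB : MeasurableSet B)
    (hinv : ∀ x y, E₀ x y → x ∈ B → y ∈ B) : haarTernary B = 0 ∨ haarTernary B = 1 := by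
  let s : ℕ → MeasurableSpace Ternary := fun n => MeasurableSpace.comap (fun x => x n) inferInstance
  have hle : ∀ n, s n ≤ MeasurableSpace.pi := fun n => (measurable_pi_apply n).comap_le
  have hind : iIndep s haarTernary :=
    iIndepFun_infinitePi (P := fun _ : ℕ => (PMF.uniformOfFintype (Fin 3)).toMeasure)
      (X := fun _ => id) fun _ => measurable_id
  refine measure_zero_or_one_of_measurableSet_limsup_atTop hle hind ?_
  rw [limsup_eq_iInf_iSup_of_nat, MeasurableSpace.measurableSet_iInf]
  intro N
  -- Overwriting the first `N` letters by 0 stays in the E₀-class, so `B = r ⁻¹' B` depends only on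
  -- coordinates from `N` on.
  let r : Ternary → Ternary := fun x n => if n < N then 0 else x n
  have hr : Measurable[⨆ n ≥ N, s n, MeasurableSpace.pi] r := by
    refine @measurable_pi_lambda _ _ _ (⨆ n ≥ N, s n) _ _ fun n => ?_
    by_cases hn : n < N
    · simp [r, hn]
    · simp only [r, hn, if_false]
      have : s n ≤ ⨆ n ≥ N, s n := le_iSup₂_of_le n (not_lt.1 hn) le_rfl
      exact (comap_measurable _).mono this le_rfl
  have hE : ∀ x, E₀ x (r x) := fun x => ⟨N, fun n hn => by simp [r, not_lt.2 hn]⟩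
  have : B = r ⁻¹' B := Set.ext fun x => ⟨hinv _ _ (hE x), hinv _ _ (E₀.symm (hE x))⟩
  rw [this]
  exact hr hB

theorem quotientMeasure_apply {A : Set (Quotient E₀')} (hA : MeasurableSet A) :
    quotientMeasure A = haarTernary (Subtype.val '' (Quotient.mk E₀' ⁻¹' A)) := by
  rw [quotientMeasure, Measure.map_apply measurable_quotient_mk'' hA,
    comap_subtype_coe_apply measurableSet_aperiodicSet]

instance isProbabilityMeasure_quotientMeasure : IsProbabilityMeasure quotientMeasure := by
  refine ⟨?_⟩
  rw [quotientMeasure_apply .univ, Set.preimage_univ, Set.image_univ, Subtype.range_coe,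
    prob_compl_eq_zero_iff measurableSet_aperiodicSet |>.1
      (countable_compl_aperiodicSet.measure_zero _)]

theorem quotientMeasure_zero_or_one {A : Set (Quotient E₀')} (hA : MeasurableSet A) :
    quotientMeasure A = 0 ∨ quotientMeasure A = 1 := by
  rw [quotientMeasure_apply hA]
  refine measure_zero_or_one_of_E₀_invariant
    (measurableSet_aperiodicSet.subtype_image (measurable_quotient_mk'' hA)) ?_
  rintro _ y h ⟨x, hx, rfl⟩
  have hy : y ∈ aperiodicSet :=
    E₀_smul_mem_aperiodicSet 1 (by rw [one_smul]; exact E₀.symm h) x.2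
  refine ⟨⟨y, hy⟩, ?_, rfl⟩
  have : Quotient.mk E₀' x = Quotient.mk E₀' ⟨y, hy⟩ := Quotient.sound h
  rwa [Set.mem_preimage, ← this]

theorem measurePreserving_smul_haarTernary (σ : S₃) :
    MeasurePreserving (fun x : Ternary => σ • x) haarTernary haarTernary := by
  refine ⟨measurable_smul_ternary σ, ?_⟩
  have h : (PMF.uniformOfFintype (Fin 3)).toMeasure.map σ =
      (PMF.uniformOfFintype (Fin 3)).toMeasure := by
    refine Measure.ext_of_singleton fun i => ?_
    rw [Measure.map_apply .of_discrete (measurableSet_singleton i)]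
    have : (σ : Fin 3 → Fin 3) ⁻¹' {i} = {σ.symm i} := by
      ext j
      simp [Equiv.eq_symm_apply]
    rw [this]
    simp
  have h2 := Measure.infinitePi_map_pi (μ := fun _ : ℕ => (PMF.uniformOfFintype (Fin 3)).toMeasure)
    (f := fun _ => (σ : Fin 3 → Fin 3)) fun _ => .of_discrete
  simp only [h] at h2
  exact h2

theorem measurable_smul_quotient (σ : S₃) : Measurable fun a : Quotient E₀' => σ • a :=
  measurable_from_quotient.2 (measurable_quotient_mk''.comp (measurable_smul_aperiodic σ))

theorem measurePreserving_smul_quotientMeasure (σ : S₃) :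
    MeasurePreserving (fun a : Quotient E₀' => σ • a) quotientMeasure quotientMeasure := by
  refine ⟨measurable_smul_quotient σ, Measure.ext fun A hA => ?_⟩
  rw [Measure.map_apply (measurable_smul_quotient σ) hA,
    quotientMeasure_apply (measurable_smul_quotient σ hA), quotientMeasure_apply hA,
    ← (measurePreserving_smul_haarTernary σ).measure_preimage
      (measurableSet_aperiodicSet.subtype_image (measurable_quotient_mk'' hA)).nullMeasurableSet]
  congr 1
  ext x
  constructor
  · rintro ⟨y, hy, rfl⟩
    exact ⟨σ • y, hy, rfl⟩
  · rintro ⟨y, hy, h⟩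
    have hx : x = (σ⁻¹ • y).1 := by
      change x = σ⁻¹ • y.1
      rw [h, inv_smul_smul]
    refine ⟨σ⁻¹ • y, ?_, hx.symm⟩
    change σ • Quotient.mk E₀' (σ⁻¹ • y) ∈ A
    rwa [smul_mk, smul_inv_smul]

/-! ### The relation `E₀(S₃) / E₀(S₂)` -/

/-- The projection from the quotient by `E₀` to the quotient by `E₀(Δ)`. -/
abbrev projGen (Δ : Subgroup S₃) : Quotient E₀' → Quotient (E₀Gen' Δ) :=
  Quotient.map id (E₀'_le_E₀Gen' Δ)

theorem projGen_surjective (Δ : Subgroup S₃) : Function.Surjective (projGen Δ) := fun u =>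
  Quotient.inductionOn u fun x => ⟨Quotient.mk E₀' x, rfl⟩

theorem projGen_smul_eq_iff (Δ : Subgroup S₃) (σ ρ : S₃) (a : Quotient E₀') :
    projGen Δ (σ • a) = projGen Δ (ρ • a) ↔ ρ * σ⁻¹ ∈ Δ := by
  induction a using Quotient.inductionOn with
  | h x => exact Quotient.eq.trans (E₀Gen'_smul_smul_iff Δ σ ρ x)

theorem quotRel_projGen_iff (Δ : Subgroup S₃) (a : Quotient E₀') (u : Quotient (E₀Gen' Δ)) :
    quotRel (E₀Gen'_mono (le_top : Δ ≤ ⊤)) (projGen Δ a) u ↔ ∃ σ : S₃, projGen Δ (σ • a) = u := by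
  induction a using Quotient.inductionOn with
  | h x =>
  induction u using Quotient.inductionOn with
  | h y =>
  refine (quotRel_mk_iff _ x y).trans ((E₀Gen'_iff ⊤ x y).trans ?_)
  constructor
  · rintro ⟨σ, -, h⟩
    exact ⟨σ, congrArg (projGen Δ) (Quotient.sound (E₀'.symm h))⟩
  · rintro ⟨σ, h⟩
    obtain ⟨δ, -, hδ⟩ := (E₀Gen'_iff Δ _ _).1 (Quotient.exact h)
    exact ⟨δ * σ, trivial, by rwa [mul_smul]⟩

theorem isBorelRel_quotRel (Δ : Subgroup S₃) :
    IsBorelRel (E₀Gen' Δ) (E₀Gen' Δ) (quotRel (E₀Gen'_mono (le_top : Δ ≤ ⊤))) := by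
  unfold IsBorelRel
  simp only [quotRel_mk_iff]
  exact measurableSet_E₀Gen' ⊤

theorem hasIndex_quotRel (Δ : Subgroup S₃) :
    HasIndex (quotRel (E₀Gen'_mono (le_top : Δ ≤ ⊤))) Δ.index := by
  intro u
  obtain ⟨a, rfl⟩ := projGen_surjective Δ u
  -- The class of `σ • a` depends on the right coset `Δσ`, whereas `S₃ ⧸ Δ` consists of left cosets;
  -- hence the inverse.
  let φ : S₃ ⧸ Δ → Quotient (E₀Gen' Δ) := Quotient.lift (fun σ : S₃ => projGen Δ (σ⁻¹ • a))
    fun σ ρ h => by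
      rw [projGen_smul_eq_iff, inv_inv]
      rw [← Quotient.eq_iff_equiv, eq_comm] at h
      exact QuotientGroup.eq.1 h
  have hφ : Function.Injective φ := by
    intro c d
    induction c using Quotient.inductionOn with
    | h σ =>
    induction d using Quotient.inductionOn with
    | h ρ =>
    intro h
    have := (projGen_smul_eq_iff Δ _ _ a).1 h
    rw [inv_inv] at this
    exact (QuotientGroup.eq.2 this).symm
  have hrange : {u | quotRel (E₀Gen'_mono (le_top : Δ ≤ ⊤)) (projGen Δ a) u} = Set.range φ := by
    ext u
    rw [Set.mem_ofPred_eq, quotRel_projGen_iff]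
    constructor
    · rintro ⟨σ, h⟩
      exact ⟨QuotientGroup.mk σ⁻¹, by rw [← h, ← inv_inv σ]; rfl⟩
    · rintro ⟨c, rfl⟩
      induction c using Quotient.inductionOn with
      | h σ => exact ⟨σ⁻¹, rfl⟩
  rw [hrange, ← Set.image_univ, hφ.encard_image, Set.encard_univ, Subgroup.index,
    ENat.card_eq_coe_natCard]

/-! ### Borel functions with graph in `E₀(S₃) / E₀(S₂)` -/

/-- No Borel lift of `f` is needed: upstairs, this set is the section of the graph of `f` along `x ↦
(x, σ • x)`. -/
theorem measurableSet_eq_projGen_smul {Δ : Subgroup S₃}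
    {f : Quotient (E₀Gen' Δ) → Quotient (E₀Gen' Δ)} (hf : IsBorelFun (E₀Gen' Δ) (E₀Gen' Δ) f)
    (σ : S₃) : MeasurableSet {a : Quotient E₀' | f (projGen Δ a) = projGen Δ (σ • a)} := by
  change MeasurableSet ((fun x : Aperiodic => (x, σ • x)) ⁻¹'
    {p | f (Quotient.mk _ p.1) = Quotient.mk _ p.2})
  exact MeasurableSet.preimage hf (measurable_id.prodMk (measurable_smul_aperiodic σ))

theorem ae_eq_of_graph_le {τ : S₃} (hτ : τ.IsSwap)
    {f : Quotient (E₀Gen' (Subgroup.zpowers τ)) → Quotient (E₀Gen' (Subgroup.zpowers τ))}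
    (hf : IsBorelFun _ _ f)
    (hgraph : ∀ u, quotRel (E₀Gen'_mono (le_top : Subgroup.zpowers τ ≤ ⊤)) u (f u)) :
    ∀ᵐ a ∂quotientMeasure, f (projGen _ a) = projGen _ a := by
  have hpos : ∃ σ : S₃, quotientMeasure {a | f (projGen _ a) = projGen _ (σ • a)} ≠ 0 := by
    by_contra! h
    have hU : (⋃ σ : S₃, {a | f (projGen (Subgroup.zpowers τ) a) = projGen _ (σ • a)}) =
        Set.univ := by
      refine Set.eq_univ_of_forall fun a => Set.mem_iUnion.2 ?_
      obtain ⟨σ, h⟩ := (quotRel_projGen_iff _ a _).1 (hgraph (projGen _ a))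
      exact ⟨σ, h.symm⟩
    have := measure_iUnion_null h
    rw [hU, measure_univ] at this
    exact one_ne_zero this
  obtain ⟨σ, hσ⟩ := hpos
  have hmeas := measurableSet_eq_projGen_smul hf σ
  have hone := (quotientMeasure_zero_or_one hmeas).resolve_left hσ
  have hae : ∀ᵐ a ∂quotientMeasure, f (projGen _ a) = projGen _ (σ • a) :=
    (prob_compl_eq_zero_iff hmeas).2 hone
  have hae' : ∀ᵐ a ∂quotientMeasure, f (projGen _ (τ • a)) = projGen _ (σ • τ • a) :=
    (measurePreserving_smul_quotientMeasure τ).quasiMeasurePreserving.ae hae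
  have hinv : ∀ a, projGen (Subgroup.zpowers τ) (τ • a) = projGen _ a := fun a => by
    have := (projGen_smul_eq_iff (Subgroup.zpowers τ) τ 1 a).2
      (by simp)
    rwa [one_smul] at this
  obtain ⟨a, h1, h2⟩ := (hae.and hae').exists
  -- One point where both identities hold suffices: it gives `σ * τ * σ⁻¹ ∈ ⟨τ⟩`.
  rw [hinv, h1, ← mul_smul, projGen_smul_eq_iff] at h2
  have hmem := mem_zpowers_of_conj_mem hτ h2
  filter_upwards [hae] with a ha
  rw [ha]
  have := (projGen_smul_eq_iff (Subgroup.zpowers τ) σ 1 a).2 (by simpa using hmem)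
  rwa [one_smul] at this

theorem isAlmostIdentity_of_isBorelCountablyGenerated {τ : S₃} (hτ : τ.IsSwap)
    (F : Setoid (Quotient (E₀Gen' (Subgroup.zpowers τ))))
    (hF : F ≤ quotRel (E₀Gen'_mono (le_top : Subgroup.zpowers τ ≤ ⊤)))
    (hgen : IsBorelCountablyGenerated _ F) : IsAlmostIdentity _ F := by
  obtain ⟨f, hf, hmem, hleast⟩ := hgen
  have hae : ∀ᵐ a ∂quotientMeasure, ∀ (n : ℕ) (σ : S₃),
      f n (projGen _ (σ • a)) = projGen _ (σ • a) :=
    ae_all_iff.2 fun n => ae_all_iff.2 fun σ =>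
      (measurePreserving_smul_quotientMeasure σ).quasiMeasurePreserving.ae
        (ae_eq_of_graph_le hτ (hf n) fun u => hF (hmem n u))
  -- the set of points of the quotient all of whose translates are fixed by the generators
  let G : Set (Quotient (E₀Gen' (Subgroup.zpowers τ))) :=
    {u | ∀ v, quotRel (E₀Gen'_mono le_top) u v → ∀ n, f n v = v}
  -- `S` is `F` cut down to equality on `G`. It is an equivalence relation because `G` is saturated
  -- for the larger relation containing `F`. It contains the graphs of all generators, so minimality
  -- of `F` gives `F ≤ S`.
  let S : Setoid (Quotient (E₀Gen' (Subgroup.zpowers τ))) :=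
    { r := fun u v => F u v ∧ (u ∈ G → u = v)
      iseqv :=
        { refl := fun u => ⟨F.refl u, fun _ => rfl⟩
          symm := fun {u v} ⟨h, h'⟩ => ⟨F.symm h, fun hv =>
            (h' fun w hw => hv w (Setoid.trans' _ (hF (F.symm h)) hw)).symm⟩
          trans := fun {u v w} ⟨h, h'⟩ ⟨k, k'⟩ => ⟨F.trans h k, fun hu => by
            have huv := h' hu
            exact huv.trans (k' (huv ▸ hu))⟩ } }
  have hS : F ≤ S := hleast fun n u => ⟨hmem n u, fun hu => (hu u (Setoid.refl' _ u) n).symm⟩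
  change quotientMeasure (nontrivialDomain _ F) = 0
  refine measure_mono_null ?_ (ae_iff.1 hae)
  intro a ha hgood
  obtain ⟨b, hab, hne⟩ := ha
  refine hne ((hS hab).2 fun v hv n => ?_).symm
  obtain ⟨σ, rfl⟩ := (quotRel_projGen_iff _ a v).1 hv
  exact hgood n σ

/-- By freeness, any `σ ∉ Δ` moves every point `a` to a different E₀(Δ)-class, so the nontrivial
domain is the whole space. -/
theorem not_isAlmostIdentity_quotRel {Δ : Subgroup S₃} (hΔ : Δ ≠ ⊤) :
    ¬ IsAlmostIdentity Δ (quotRel (E₀Gen'_mono (le_top : Δ ≤ ⊤))) := by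
  obtain ⟨σ, hσ⟩ : ∃ σ, σ ∉ Δ := by
    by_contra! h
    exact hΔ ((Subgroup.eq_top_iff' Δ).2 h)
  have huniv : nontrivialDomain Δ (quotRel (E₀Gen'_mono (le_top : Δ ≤ ⊤))) = Set.univ := by
    refine Set.eq_univ_of_forall fun a => ⟨projGen Δ (σ • a), ?_, fun h => hσ ?_⟩
    · exact (quotRel_projGen_iff Δ a _).2 ⟨σ, rfl⟩
    · have h' : projGen Δ ((1 : S₃) • a) = projGen Δ (σ • a) := by
        rw [one_smul]
        exact h.symm
      simpa using (projGen_smul_eq_iff Δ 1 σ a).1 h'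
  rw [IsAlmostIdentity, huniv, measure_univ]
  exact one_ne_zero

end QuotientBorel

open QuotientBorel in
theorem mainTheorem5 :
    -- the space of aperiodic sequences
    (aperiodicSetᶜ.Countable ∧ IsGδ aperiodicSet ∧
      ∀ x y : Ternary, E₀Gen ⊤ x y → x ∈ aperiodicSet → y ∈ aperiodicSet) ∧
    -- the relations, as countable Borel equivalence relations on the aperiodic sequences
    (IsQuotientBorelSpace E₀' ∧ ∀ Δ : Subgroup S₃, IsQuotientBorelSpace (E₀Gen' Δ)) ∧
    -- the action of `S₃` modulo `E₀` is Borel and free, and its restriction to each subgroup `Δ`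
    -- has orbit equivalence relation `E₀(Δ) / E₀`
    ((∀ σ : S₃, IsBorelFun E₀' E₀' (fun a => σ • a)) ∧
      (∀ (σ : S₃) (a : Quotient E₀'), σ • a = a → σ = 1) ∧
      ∀ Δ : Subgroup S₃,
        quotRel (E₀'_le_E₀Gen' Δ) = MulAction.orbitRel Δ (Quotient E₀')) ∧
    -- the quotient measure is a two-valued invariant probability measure
    (MeasureTheory.IsProbabilityMeasure quotientMeasure ∧
      (∀ A : Set (Quotient E₀'), MeasurableSet A →
        quotientMeasure A = 0 ∨ quotientMeasure A = 1) ∧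
      ∀ σ : S₃, MeasureTheory.MeasurePreserving (fun a : Quotient E₀' => σ • a)
        quotientMeasure quotientMeasure) ∧
    -- for each subgroup `S₂` generated by a transposition
    ∀ (τ : S₃), τ.IsSwap → ∀ S₂ : Subgroup S₃, S₂ = Subgroup.zpowers τ →
      S₂.index = 3 ∧
      Subgroup.normalizer (S₂ : Set S₃) = S₂ ∧
      IsBorelRel (E₀Gen' S₂) (E₀Gen' S₂) (quotRel (E₀Gen'_mono (le_top : S₂ ≤ ⊤))) ∧
      HasIndex (quotRel (E₀Gen'_mono (le_top : S₂ ≤ ⊤))) 3 ∧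
      (∀ F : Setoid (Quotient (E₀Gen' S₂)),
        F ≤ quotRel (E₀Gen'_mono (le_top : S₂ ≤ ⊤)) →
        IsBorelCountablyGenerated (E₀Gen' S₂) F → IsAlmostIdentity S₂ F) ∧
      ¬ IsBorelCountablyGenerated (E₀Gen' S₂) (quotRel (E₀Gen'_mono (le_top : S₂ ≤ ⊤))) := by
  refine ⟨⟨countable_compl_aperiodicSet, isGδ_aperiodicSet, fun x y h hx => ?_⟩,
    ⟨isQuotientBorelSpace_E₀', isQuotientBorelSpace_E₀Gen'⟩,
    ⟨isBorelFun_smul, eq_one_of_smul_eq, quotRel_eq_orbitRel⟩,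
    ⟨isProbabilityMeasure_quotientMeasure, fun A => quotientMeasure_zero_or_one,
      measurePreserving_smul_quotientMeasure⟩, ?_⟩
  · obtain ⟨σ, -, h⟩ := (E₀Gen_iff ⊤ x y).1 h
    exact E₀_smul_mem_aperiodicSet σ h hx
  rintro τ hτ S₂ rfl
  have hidx := index_zpowers_isSwap hτ
  have h3 := hasIndex_quotRel (Subgroup.zpowers τ)
  rw [hidx] at h3
  refine ⟨hidx, normalizer_zpowers_isSwap hτ, isBorelRel_quotRel _, h3,
    isAlmostIdentity_of_isBorelCountablyGenerated hτ, fun h => ?_⟩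
  refine not_isAlmostIdentity_quotRel ?_
    (isAlmostIdentity_of_isBorelCountablyGenerated hτ _ le_rfl h)
  intro htop
  rw [htop, Subgroup.index_top] at hidx
  omega
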